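/- For $n\ge 1$ and $\beta\in\mathbb R$, let $X_1,\dots,X_n$ be i.i.d. with $\mathbb P(X_k=1)=\mathbb P(X_k=-1)=\tfrac12$, let $S_n=\sum_{k=1}^n X_k$, and let $(X^{(\beta)}_1,\dots,X^{(\beta)}_n)$ be the Curie–Weiss spins at inverse temperature $\beta$, i.e. a random vector whose law is $$\frac{e^{\frac{\beta}{2n}S_n^2}}{\mathbb E\big[e^{\frac{\beta}{2n}S_n^2}\big]}\bullet \mathbb P_{(X_1,\dots,X_n)},$$ the law of $(X_1,\dots,X_n)$ reweighted by the displayed density. Let $M_n^{(\beta)}=\sum_{k=1}^n X_k^{(\beta)}$ be the unnormalised magnetisation. For $\gamma\in\mathbb R$ let $F_\gamma$ be a real random variable with density $\frac1{\mathcal Z_\gamma}e^{-\gamma x^2/2-x^4/12}$, where $\mathcal Z_\gamma=\int_{\mathbb R}e^{-\gamma x^2/2-x^4/12}\,dx$, and let $B$ be a random sign, $\mathbb P(B=1)=\mathbb P(B=-1)=\tfrac12$. All convergences below are in distribution as $n\to\infty$. 1. If $\beta<1$, then $\dfrac{M_n^{(\beta)}}{\sqrt n}\to\mathcal N\!\left(0,\dfrac1{1-\beta}\right)$.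 2. If $\beta=1$, then $\dfrac{M_n^{(1)}}{n^{3/4}}\to F_0$, whose density is proportional to $e^{-x^4/12}$. Moreover $F_0$ has the same law as $B\,\big(12\,\boldsymbol\gamma(1/4)\big)^{1/4}$, where $\boldsymbol\gamma(1/4)$ is independent of $B$ and Gamma-distributed with density $\frac{1}{\Gamma(1/4)}x^{-3/4}e^{-x}\mathbf 1_{x>0}$. 3. For every fixed $\gamma\in\mathbb R$, $\dfrac{M_n^{(1-\gamma/\sqrt n)}}{n^{3/4}}\to F_\gamma$. 4. If $\beta>1$, the equation $t=\tanh(\beta t)$ has exactly one solution $t_\beta>0$, and $\dfrac{M_n^{(\beta)}}{n}\to t_\beta\,B$. -/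

import Mathlib

open MeasureTheory ProbabilityTheory Filter

noncomputable section

namespace CurieWeiss

/-- The symmetric sign law `Ber_{±1}(1/2)` on `ℝ`: mass `1/2` at `1` and mass `1/2` at `-1`. -/
def signLaw : Measure ℝ :=
  bernoulliMeasure (1 : ℝ) (-1) (⟨1 / 2, by norm_num, by norm_num⟩ : unitInterval)

instance : IsProbabilityMeasure signLaw := by
  unfold signLaw; infer_instance

/-- The total spin `∑ₖ xₖ` of a configuration of `n` spins. Under the law `spinLaw n β` this is
the unnormalised magnetisation. -/
def magnetisation (n : ℕ) (x : Fin n → ℝ) : ℝ := ∑ k, x k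

/-- The Curie-Weiss law of `n` spins at inverse temperature `β` and zero external field: the law of
`n` i.i.d. symmetric signs, tilted by the normalised weight `exp (β / (2 n) * (∑ₖ xₖ) ^ 2)`. -/
def spinLaw (n : ℕ) (β : ℝ) : Measure (Fin n → ℝ) :=
  (Measure.pi fun _ : Fin n => signLaw).tilted
    fun x => β / (2 * n) * magnetisation n x ^ 2

/-- The law on `ℝ` whose density is proportional to `exp (-γ x² / 2 - x⁴ / 12)`. -/
def quarticLaw (γ : ℝ) : Measure ℝ :=
  (volume : Measure ℝ).tilted fun x => -γ * x ^ 2 / 2 - x ^ 4 / 12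

theorem measurable_magnetisation (n : ℕ) : Measurable (magnetisation n) := by
  unfold magnetisation; fun_prop

theorem ae_signLaw : ∀ᵐ x ∂signLaw, |x| ≤ 1 := by
  simp only [signLaw, bernoulliMeasure, ae_add_measure_iff]
  constructor <;>
    exact Measure.ae_smul_measure ((ae_dirac_iff (measurableSet_le (by fun_prop) (by fun_prop))).2
      (by simp)) _

instance (n : ℕ) (β : ℝ) : IsProbabilityMeasure (spinLaw n β) := by
  refine isProbabilityMeasure_tilted ?_
  have hm := measurable_magnetisation n
  refine Integrable.of_bound (C := Real.exp (|β / (2 * n)| * (n : ℝ) ^ 2))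
    (by fun_prop) ?_
  have h : ∀ᵐ x ∂(Measure.pi fun _ : Fin n => signLaw), ∀ i, |x i| ≤ 1 :=
    ae_all_iff.2 fun i =>
      (Measure.quasiMeasurePreserving_eval (fun _ : Fin n => signLaw) i).ae ae_signLaw
  filter_upwards [h] with x hx
  rw [Real.norm_eq_abs, Real.abs_exp, Real.exp_le_exp]
  have h1 : |magnetisation n x| ≤ n := by
    calc |magnetisation n x| ≤ ∑ k, |x k| := Finset.abs_sum_le_sum_abs _ _
      _ ≤ ∑ _k : Fin n, (1 : ℝ) := Finset.sum_le_sum fun k _ => hx k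
      _ = n := by simp
  have h2 : magnetisation n x ^ 2 ≤ (n : ℝ) ^ 2 := by
    rw [← sq_abs]; gcongr
  calc β / (2 * n) * magnetisation n x ^ 2
      ≤ |β / (2 * n)| * magnetisation n x ^ 2 := by gcongr; exact le_abs_self _
    _ ≤ _ := by gcongr

instance (γ : ℝ) : IsProbabilityMeasure (quarticLaw γ) := by
  refine isProbabilityMeasure_tilted ?_
  refine (((integrable_exp_neg_mul_sq one_pos).const_mul
    (Real.exp (3 * (1 - γ / 2) ^ 2)))).mono' (by fun_prop) (ae_of_all _ fun x => ?_)
  rw [Real.norm_eq_abs, Real.abs_exp, ← Real.exp_add, Real.exp_le_exp]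
  nlinarith [sq_nonneg (x ^ 2 / 6 - (1 - γ / 2))]

end CurieWeiss

end

/-!
Convolving the law of `M_n / r` with a Gaussian of variance `n / (β r²)` turns the square
`exp (β M_n² / (2 n))` into the linear weight `exp (β r u M_n / n)` (Hubbard-Stratonovich), over
which the i.i.d. spins integrate to `cosh (β r u / n) ^ n`. The smoothed law therefore has density
proportional to `exp (-n I(r u / n))` with `I(u) = β u² / 2 - log (cosh (β u))`, and the regimes are
the Laplace asymptotics of this density: for `β < 1` the minimum of `I` at `0` is quadratic, near
`β = 1` it is quartic, and for `β > 1` there are two minima `± t`. The characteristic function of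
the Gaussian noise never vanishes and converges, so it can be divided out.

At the critical point the limit `F₀` is symmetric, so `F₀` is `|F₀|` times an independent sign, and
the substitution `y = x⁴ / 12` turns the density `exp (-x⁴ / 12)` into that of a Gamma variable.
-/

open scoped Topology NNReal ENNReal

namespace CurieWeiss

section Tilted

variable {α : Type*} {mα : MeasurableSpace α} {μ : Measure α}

theorem integrable_exp_of_isProbabilityMeasure_tilted {f : α → ℝ}
    [IsProbabilityMeasure (μ.tilted f)] : Integrable (fun x => Real.exp (f x)) μ := by
  by_contra hf
  exact IsProbabilityMeasure.ne_zero (μ.tilted f) (tilted_of_not_integrable hf)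

theorem eq_tilted_of_eq_smul_withDensity {P : Measure α} [IsProbabilityMeasure P] {c : ℝ≥0∞}
    {f : α → ℝ} (hf : Measurable f)
    (hP : P = c • μ.withDensity fun x => ENNReal.ofReal (Real.exp (f x))) :
    P = μ.tilted f := by
  set I := ∫⁻ x, ENNReal.ofReal (Real.exp (f x)) ∂μ
  have hmass : c * I = 1 := by
    rw [← measure_univ (μ := P), hP, Measure.smul_apply, withDensity_apply _ .univ,
      setLIntegral_univ, smul_eq_mul]
  have hI0 : I ≠ 0 := right_ne_zero_of_mul_eq_one hmass
  have hc0 : c ≠ 0 := left_ne_zero_of_mul_eq_one hmass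
  have hI : I ≠ ∞ := fun h => by simp [h, hc0] at hmass
  have hint : Integrable (fun x => Real.exp (f x)) μ :=
    ⟨by fun_prop, by
      rw [hasFiniteIntegral_iff_ofReal (ae_of_all _ fun x => (Real.exp_pos _).le)]
      exact hI.lt_top⟩
  have hc : c = ENNReal.ofReal (∫ x, Real.exp (f x) ∂μ)⁻¹ := by
    rw [integral_eq_lintegral_of_nonneg_ae (ae_of_all _ fun x => (Real.exp_pos _).le) hint.1,
      ← ENNReal.toReal_inv, ENNReal.ofReal_toReal (ENNReal.inv_ne_top.2 hI0)]
    exact ENNReal.eq_inv_of_mul_eq_one_left hmass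
  rw [hP, Measure.tilted, ← withDensity_smul _ (by fun_prop)]
  congr 1
  ext x
  rw [Pi.smul_apply, smul_eq_mul, hc, div_eq_inv_mul, ENNReal.ofReal_mul' (Real.exp_pos _).le]

theorem map_tilted_comp {β : Type*} {mβ : MeasurableSpace β} {φ : α → β} (hφ : Measurable φ)
    {g : β → ℝ} (hg : Measurable g) :
    (μ.tilted fun x => g (φ x)).map φ = (μ.map φ).tilted g := by
  refine Measure.ext_of_lintegral _ fun F hF => ?_
  rw [lintegral_map hF hφ, lintegral_tilted, lintegral_tilted, lintegral_map (by fun_prop) hφ,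
    integral_map hφ.aemeasurable (by fun_prop)]

theorem isNegInvariant_map {β : Type*} {mβ : MeasurableSpace β} [Neg α] [Neg β] [MeasurableNeg α]
    [MeasurableNeg β] [μ.IsNegInvariant] {φ : α → β} (hφ : Measurable φ)
    (hodd : ∀ x, φ (-x) = -φ x) : (μ.map φ).IsNegInvariant where
  neg_eq_self := by
    rw [Measure.neg_def, Measure.map_map measurable_neg hφ]
    calc μ.map (Neg.neg ∘ φ) = (μ.map Neg.neg).map φ := by
          rw [Measure.map_map hφ measurable_neg]
          congr 1 with x
          exact (hodd x).symm
      _ = μ.map φ := by rw [Measure.map_neg_eq_self]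

theorem isNegInvariant_tilted [InvolutiveNeg α] [MeasurableNeg α] [μ.IsNegInvariant] {f : α → ℝ}
    (hf : Measurable f) (heven : ∀ x, f (-x) = f x) : (μ.tilted f).IsNegInvariant where
  neg_eq_self := by
    calc (μ.tilted f).neg = (μ.tilted fun x => f (-x)).map Neg.neg := by
          simp_rw [heven]; rfl
      _ = μ.tilted f := by rw [map_tilted_comp measurable_neg hf, Measure.map_neg_eq_self]

theorem tendsto_integral_tilted {E : Type*} [NormedAddCommGroup E] [NormedSpace ℝ E]
    [NeZero μ] {f : ℕ → α → ℝ} {g b : α → ℝ} (hf : ∀ n, Measurable (f n))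
    (hb : Integrable (fun x => Real.exp (b x)) μ)
    (hfb : ∀ᶠ n in atTop, ∀ x, f n x ≤ b x)
    (hlim : ∀ x, Tendsto (fun n => f n x) atTop (𝓝 (g x)))
    {φ : α → E} (hφ : AEStronglyMeasurable φ μ) {C : ℝ} (hC : ∀ x, ‖φ x‖ ≤ C) :
    Tendsto (fun n => ∫ x, φ x ∂μ.tilted (f n)) atTop (𝓝 (∫ x, φ x ∂μ.tilted g)) := by
  have hgb : ∀ x, g x ≤ b x := fun x => le_of_tendsto (hlim x) (hfb.mono fun n h => h x)
  have hg : Measurable g := measurable_of_tendsto_metrizable hf (tendsto_pi_nhds.2 hlim)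
  have hgint : Integrable (fun x => Real.exp (g x)) μ :=
    hb.mono' (by fun_prop) (ae_of_all _ fun x => by
      rw [Real.norm_eq_abs, Real.abs_exp]; exact Real.exp_le_exp.2 (hgb x))
  have hden : Tendsto (fun n => ∫ x, Real.exp (f n x) ∂μ) atTop (𝓝 (∫ x, Real.exp (g x) ∂μ)) := by
    refine tendsto_integral_filter_of_dominated_convergence (fun x => Real.exp (b x))
      (.of_forall fun n => by fun_prop) (hfb.mono fun n h => ae_of_all _ fun x => ?_) hb
      (ae_of_all _ fun x => (Real.continuous_exp.tendsto _).comp (hlim x))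
    rw [Real.norm_eq_abs, Real.abs_exp]
    exact Real.exp_le_exp.2 (h x)
  have hnum : Tendsto (fun n => ∫ x, Real.exp (f n x) • φ x ∂μ) atTop
      (𝓝 (∫ x, Real.exp (g x) • φ x ∂μ)) := by
    refine tendsto_integral_filter_of_dominated_convergence (fun x => Real.exp (b x) * C)
      (.of_forall fun n => (hf n).exp.aestronglyMeasurable.smul hφ)
      (hfb.mono fun n h => ae_of_all _ fun x => ?_)
      (hb.mul_const C)
      (ae_of_all _ fun x => ((Real.continuous_exp.tendsto _).comp (hlim x)).smul_const _)
    rw [norm_smul, Real.norm_eq_abs, Real.abs_exp]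
    exact mul_le_mul (Real.exp_le_exp.2 (h x)) (hC x) (norm_nonneg _) (Real.exp_pos _).le
  simp_rw [integral_tilted, div_eq_inv_mul, mul_smul, integral_smul]
  exact (hden.inv₀ (integral_exp_pos hgint).ne').smul hnum

end Tilted

section CharFun

theorem tendstoInDistribution_of_tendsto_charFun {Ω : ℕ → Type*} {Ω' : Type*}
    [∀ n, MeasurableSpace (Ω n)] [MeasurableSpace Ω'] {X : ∀ n, Ω n → ℝ} {Z : Ω' → ℝ}
    {P : ∀ n, Measure (Ω n)} {Q : Measure Ω'} [∀ n, IsProbabilityMeasure (P n)]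
    [IsProbabilityMeasure Q] (hX : ∀ n, Measurable (X n)) (hZ : Measurable Z)
    (h : ∀ ξ, Tendsto (fun n => charFun ((P n).map (X n)) ξ) atTop (𝓝 (charFun (Q.map Z) ξ))) :
    TendstoInDistribution X atTop Z P Q where
  forall_aemeasurable n := (hX n).aemeasurable
  aemeasurable_limit := hZ.aemeasurable
  tendsto := ProbabilityMeasure.tendsto_of_tendsto_charFun h

theorem tendsto_charFun_of_tendsto_charFun_conv_gaussianReal {P : ℕ → Measure ℝ} {Q : Measure ℝ}
    [∀ n, IsFiniteMeasure (P n)] [IsFiniteMeasure Q] {v : ℕ → ℝ≥0} {w : ℝ≥0} {ξ : ℝ}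
    (hv : Tendsto v atTop (𝓝 w))
    (h : Tendsto (fun n => charFun (P n ∗ gaussianReal 0 (v n)) ξ) atTop
      (𝓝 (charFun (Q ∗ gaussianReal 0 w) ξ))) :
    Tendsto (fun n => charFun (P n) ξ) atTop (𝓝 (charFun Q ξ)) := by
  have hnoise : Tendsto (fun n => charFun (gaussianReal 0 (v n)) ξ) atTop
      (𝓝 (charFun (gaussianReal 0 w) ξ)) := by
    simp only [charFun_gaussianReal]
    have hv' : Tendsto (fun n => ((v n : ℝ) : ℂ)) atTop (𝓝 ((w : ℝ) : ℂ)) :=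
      ((Complex.continuous_ofReal.comp NNReal.continuous_coe).tendsto w).comp hv
    exact (Complex.continuous_exp.tendsto _).comp
      (((hv'.mul_const _).div_const _).const_sub _)
  have hne : ∀ u : ℝ≥0, charFun (gaussianReal 0 u) ξ ≠ 0 := fun u => by
    rw [charFun_gaussianReal]; exact Complex.exp_ne_zero _
  simp only [charFun_conv] at h
  have hquot := h.div hnoise (hne w)
  simp only [Pi.div_def, mul_div_cancel_right₀ _ (hne _)] at hquot
  exact hquot

theorem tendsto_charFun_tilted {P : ℕ → Measure ℝ} {Q : Measure ℝ}
    [∀ n, IsProbabilityMeasure (P n)] [IsProbabilityMeasure Q]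
    (h : ∀ ξ, Tendsto (fun n => charFun (P n) ξ) atTop (𝓝 (charFun Q ξ)))
    {g : ℝ → ℝ} (hg : Continuous g) {C : ℝ} (hC : ∀ x, g x ≤ C) (ξ : ℝ) :
    Tendsto (fun n => charFun ((P n).tilted g) ξ) atTop (𝓝 (charFun (Q.tilted g) ξ)) := by
  let weight : BoundedContinuousFunction ℝ ℂ :=
    .ofNormedAddCommGroup (fun x => (Real.exp (g x) : ℂ)) (by fun_prop) (Real.exp C) fun x => by
      simpa [Complex.norm_exp] using hC x
  have hweak : ∀ F : BoundedContinuousFunction ℝ ℂ,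
      Tendsto (fun n => ∫ x, F x ∂P n) atTop (𝓝 (∫ x, F x ∂Q)) :=
    (ProbabilityMeasure.tendsto_iff_forall_integral_rclike_tendsto ℂ
      (μs := fun n => ⟨P n, inferInstance⟩) (μ := ⟨Q, inferInstance⟩)).1
      (ProbabilityMeasure.tendsto_of_tendsto_charFun h)
  have hexp : Integrable (fun x => Real.exp (g x)) Q :=
    .of_bound (C := Real.exp C) (by fun_prop) (ae_of_all _ fun x => by simpa using hC x)
  have hratio : ∀ ν : Measure ℝ, charFun (ν.tilted g) ξ =
      (∫ x, (weight * BoundedContinuousFunction.innerProbChar ξ) x ∂ν) / ∫ x, weight x ∂ν := by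
    intro ν
    have hden : ∫ x, weight x ∂ν = ((∫ x, Real.exp (g x) ∂ν : ℝ) : ℂ) := integral_ofReal
    rw [charFun_eq_integral_innerProbChar, integral_tilted, hden, ← integral_div]
    refine integral_congr_ae (ae_of_all _ fun x => ?_)
    simp [weight, Complex.real_smul, div_mul_eq_mul_div]
  simp_rw [hratio]
  refine (hweak _).div (hweak weight) ?_
  rw [show ∫ x, weight x ∂Q = ((∫ x, Real.exp (g x) ∂Q : ℝ) : ℂ) from integral_ofReal]
  exact Complex.ofReal_ne_zero.2 (integral_exp_pos hexp).ne'

theorem charFun_eq_integral_cos {μ : Measure ℝ} [IsFiniteMeasure μ] [μ.IsNegInvariant] (ξ : ℝ) :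
    charFun μ ξ = ((∫ x, Real.cos (ξ * x) ∂μ : ℝ) : ℂ) := by
  have hint : Integrable (fun x : ℝ => Complex.exp (ξ * x * Complex.I)) μ :=
    .of_bound (C := 1) (by fun_prop) (ae_of_all _ fun x => by
      rw [← Complex.ofReal_mul, Complex.norm_exp_ofReal_mul_I])
  have hre : (charFun μ ξ).re = ∫ x, Real.cos (ξ * x) ∂μ := by
    rw [charFun_apply_real, ← RCLike.re_eq_complex_re, ← integral_re hint]
    congr 1 with x
    rw [← Complex.ofReal_mul, RCLike.re_eq_complex_re, Complex.exp_ofReal_mul_I_re]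
  have hconj : (starRingEnd ℂ) (charFun μ ξ) = charFun μ ξ := by
    rw [← charFun_neg]
    nth_rw 2 [← μ.map_neg_eq_self]
    rw [charFun_apply_real, charFun_apply_real, integral_map (by fun_prop) (by fun_prop)]
    simp
  rw [← hre, Complex.conj_eq_iff_re.1 hconj]

end CharFun

section HubbardStratonovich

theorem gaussianReal_zero_eq_tilted {v : ℝ≥0} (hv : v ≠ 0) :
    gaussianReal 0 v = volume.tilted fun x => -x ^ 2 / (2 * v) := by
  refine eq_tilted_of_eq_smul_withDensity (c := ENNReal.ofReal (√(2 * Real.pi * v))⁻¹)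
    (by fun_prop) ?_
  rw [gaussianReal_of_var_ne_zero 0 hv, ← withDensity_smul _ (by fun_prop)]
  congr 1 with x
  rw [Pi.smul_apply, smul_eq_mul, ← ENNReal.ofReal_mul (by positivity), gaussianPDF,
    gaussianPDFReal, sub_zero]

theorem tilted_gaussianReal_zero {v w : ℝ≥0} (hv : v ≠ 0) (hw : w ≠ 0) :
    ((gaussianReal 0 v).tilted fun x => ((v : ℝ)⁻¹ - (w : ℝ)⁻¹) * x ^ 2 / 2) =
      gaussianReal 0 w := by
  have hv' : (v : ℝ) ≠ 0 := by exact_mod_cast hv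
  have hw' : (w : ℝ) ≠ 0 := by exact_mod_cast hw
  have : IsProbabilityMeasure (volume.tilted fun x : ℝ => -x ^ 2 / (2 * v)) :=
    gaussianReal_zero_eq_tilted hv ▸ inferInstance
  rw [gaussianReal_zero_eq_tilted hv, gaussianReal_zero_eq_tilted hw,
    tilted_tilted integrable_exp_of_isProbabilityMeasure_tilted]
  congr 1 with x
  rw [Pi.add_apply]
  field_simp
  ring

variable {μ : Measure ℝ} {v : ℝ≥0}

theorem measurable_gaussianPDFReal_prod (v : ℝ≥0) :
    Measurable fun p : ℝ × ℝ => gaussianPDFReal p.1 v p.2 := by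
  simp only [gaussianPDFReal]
  fun_prop

theorem lintegral_const_add_gaussianReal_zero (hv : v ≠ 0) {F : ℝ → ℝ≥0∞} (hF : Measurable F)
    (x : ℝ) :
    ∫⁻ y, F (x + y) ∂gaussianReal 0 v = ∫⁻ u, ENNReal.ofReal (gaussianPDFReal x v u) * F u := by
  rw [← lintegral_map hF (measurable_const_add x), gaussianReal_map_const_add, zero_add,
    gaussianReal_of_var_ne_zero _ hv, lintegral_withDensity_eq_lintegral_mul _ (by fun_prop) hF]
  rfl

theorem integrable_exp_mul_of_integrable_exp_sq [IsFiniteMeasure μ] (hv : v ≠ 0)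
    (h : Integrable (fun x => Real.exp (x ^ 2 / (2 * v))) μ) (t : ℝ) :
    Integrable (fun x => Real.exp (t * x)) μ := by
  have : (0 : ℝ) < v := by exact_mod_cast hv.bot_lt
  refine (h.const_mul (Real.exp (v * t ^ 2 / 2))).mono' (by fun_prop) (ae_of_all _ fun x => ?_)
  rw [Real.norm_eq_abs, Real.abs_exp, ← Real.exp_add, Real.exp_le_exp]
  have : v * t ^ 2 / 2 + x ^ 2 / (2 * v) - t * x = (v * t - x) ^ 2 / (2 * v) := by
    field_simp
    ring
  linarith [show 0 ≤ (v * t - x) ^ 2 / (2 * v) by positivity]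

theorem measurable_cgf_of_integrable_exp_sq [IsFiniteMeasure μ] (hv : v ≠ 0)
    (h : Integrable (fun x => Real.exp (x ^ 2 / (2 * v))) μ) : Measurable (cgf id μ) :=
  (continuous_mgf (integrable_exp_mul_of_integrable_exp_sq hv h)).measurable.log

theorem exp_sq_mul_gaussianPDFReal (hv : v ≠ 0) (x u : ℝ) :
    Real.exp (x ^ 2 / (2 * v)) * gaussianPDFReal x v u =
      (√(2 * Real.pi * v))⁻¹ * (Real.exp (-u ^ 2 / (2 * v)) * Real.exp (u / v * x)) := by
  have hv' : (v : ℝ) ≠ 0 := by exact_mod_cast hv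
  rw [gaussianPDFReal, mul_left_comm, ← Real.exp_add, ← Real.exp_add]
  congr 2
  field_simp
  ring

theorem lintegral_exp_sq_mul_gaussianPDFReal [IsProbabilityMeasure μ] (hv : v ≠ 0)
    (h : Integrable (fun x => Real.exp (x ^ 2 / (2 * v))) μ) (u : ℝ) :
    ∫⁻ x, ENNReal.ofReal (Real.exp (x ^ 2 / (2 * v)) * gaussianPDFReal x v u) ∂μ =
      ENNReal.ofReal (√(2 * Real.pi * v))⁻¹ *
        ENNReal.ofReal (Real.exp (cgf id μ (u / v) - u ^ 2 / (2 * v))) := by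
  have hexp := integrable_exp_mul_of_integrable_exp_sq hv h
  simp_rw [exp_sq_mul_gaussianPDFReal hv]
  rw [← ofReal_integral_eq_lintegral_ofReal (((hexp _).const_mul _).const_mul _)
      (ae_of_all _ fun x => by positivity), integral_const_mul, integral_const_mul,
    ← ENNReal.ofReal_mul (by positivity), sub_eq_neg_add, Real.exp_add,
    exp_cgf (X := id) (hexp _), neg_div]
  rfl

theorem tilted_sq_conv_gaussianReal [IsProbabilityMeasure μ] (hv : v ≠ 0)
    (h : Integrable (fun x => Real.exp (x ^ 2 / (2 * v))) μ) :
    (μ.tilted fun x => x ^ 2 / (2 * v)) ∗ gaussianReal 0 v =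
      volume.tilted fun u => cgf id μ (u / v) - u ^ 2 / (2 * v) := by
  have := isProbabilityMeasure_tilted h
  have hcgf : Measurable fun u => cgf id μ (u / v) :=
    (measurable_cgf_of_integrable_exp_sq hv h).comp (measurable_id.div_const _)
  set Z := ∫ x, Real.exp (x ^ 2 / (2 * v)) ∂μ with hZ
  refine eq_tilted_of_eq_smul_withDensity
    (c := ENNReal.ofReal Z⁻¹ * ENNReal.ofReal (√(2 * Real.pi * v))⁻¹)
    (hcgf.sub (by fun_prop)) (Measure.ext_of_lintegral _ fun F hF => ?_)
  have hweight : ∀ x, ENNReal.ofReal (Real.exp (x ^ 2 / (2 * v)) / Z) =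
      ENNReal.ofReal Z⁻¹ * ENNReal.ofReal (Real.exp (x ^ 2 / (2 * v))) := fun x => by
    rw [div_eq_inv_mul, ENNReal.ofReal_mul' (Real.exp_pos _).le]
  calc ∫⁻ z, F z ∂((μ.tilted fun x => x ^ 2 / (2 * v)) ∗ gaussianReal 0 v)
      = ∫⁻ x, (∫⁻ u, ENNReal.ofReal Z⁻¹ *
          (ENNReal.ofReal (Real.exp (x ^ 2 / (2 * v)) * gaussianPDFReal x v u) * F u)) ∂μ := by
        rw [Measure.lintegral_conv hF, lintegral_tilted, ← hZ]
        simp_rw [lintegral_const_add_gaussianReal_zero hv hF, hweight, mul_assoc,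
          ← lintegral_const_mul' _ _ ENNReal.ofReal_ne_top,
          ENNReal.ofReal_mul (Real.exp_pos _).le, mul_assoc]
    _ = ∫⁻ u, ∫⁻ x, ENNReal.ofReal Z⁻¹ *
          (ENNReal.ofReal (Real.exp (x ^ 2 / (2 * v)) * gaussianPDFReal x v u) * F u) ∂μ := by
        refine lintegral_lintegral_swap (Measurable.aemeasurable ?_)
        have hsq : Measurable fun p : ℝ × ℝ => Real.exp (p.1 ^ 2 / (2 * v)) := by fun_prop
        exact ((hsq.mul (measurable_gaussianPDFReal_prod v)).ennreal_ofReal.mul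
          (hF.comp measurable_snd)).const_mul _
    _ = ∫⁻ u, ENNReal.ofReal Z⁻¹ * ENNReal.ofReal (√(2 * Real.pi * v))⁻¹ *
          (ENNReal.ofReal (Real.exp (cgf id μ (u / v) - u ^ 2 / (2 * v))) * F u) := by
        congr 1 with u
        rw [lintegral_const_mul' _ _ ENNReal.ofReal_ne_top, lintegral_mul_const _ (by fun_prop),
          lintegral_exp_sq_mul_gaussianPDFReal hv h]
        ring
    _ = _ := by
        rw [lintegral_smul_measure, lintegral_withDensity_eq_lintegral_mul _ (by fun_prop) hF,
          lintegral_const_mul' _ _ (by finiteness)]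
        rfl

end HubbardStratonovich

section SpinLaw

instance : signLaw.IsNegInvariant where
  neg_eq_self := by
    rw [Measure.neg_def, signLaw, map_bernoulliMeasure' _ _ measurable_neg, bernoulliMeasure_def,
      bernoulliMeasure_def, neg_neg, add_comm]
    congr 3 <;> ext <;> norm_num

theorem integral_signLaw {E : Type*} [NormedAddCommGroup E] [NormedSpace ℝ E] [CompleteSpace E]
    (f : ℝ → E) :
    ∫ x, f x ∂signLaw = (1 / 2 : ℝ) • f 1 + (1 / 2 : ℝ) • f (-1) := by
  rw [signLaw, integral_bernoulliMeasure]
  norm_num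

theorem mgf_id_signLaw (t : ℝ) : mgf id signLaw t = Real.cosh t := by
  rw [mgf, integral_signLaw, Real.cosh_eq, smul_eq_mul, smul_eq_mul]
  simp only [id, mul_one, mul_neg]
  ring

theorem mgf_magnetisation (n : ℕ) (t : ℝ) :
    mgf (magnetisation n) (Measure.pi fun _ => signLaw) t = Real.cosh t ^ n := by
  have hprod : ∀ x : Fin n → ℝ, Real.exp (t * magnetisation n x) = ∏ i, Real.exp (t * x i) :=
    fun x => by rw [magnetisation, ← Real.exp_sum, Finset.mul_sum]
  simp_rw [mgf, hprod]
  rw [integral_fintype_prod_eq_prod fun _ y => Real.exp (t * y)]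
  simpa [mgf] using congrArg (· ^ n) (mgf_id_signLaw t)

theorem cgf_map_magnetisation_div (n : ℕ) (r t : ℝ) :
    cgf id ((Measure.pi fun _ => signLaw).map fun x => magnetisation n x / r) t =
      n * Real.log (Real.cosh (t / r)) := by
  rw [cgf, mgf_id_map ((measurable_magnetisation n).div_const r).aemeasurable, ← Real.log_pow,
    ← mgf_magnetisation]
  simp only [mgf, div_mul_eq_mul_div, mul_div_assoc]

theorem map_spinLaw_magnetisation_div (n : ℕ) (β : ℝ) {r : ℝ} (hr : r ≠ 0) :
    (spinLaw n β).map (fun x => magnetisation n x / r) =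
      ((Measure.pi fun _ => signLaw).map fun x => magnetisation n x / r).tilted
        fun y => β * r ^ 2 / (2 * n) * y ^ 2 := by
  rw [← map_tilted_comp ((measurable_magnetisation n).div_const r) (by fun_prop), spinLaw]
  congr 2 with x
  field_simp

/-- The mean-field free energy of the Curie-Weiss model, as a function of the magnetisation per
spin `u`: up to a Gaussian noise of variance `1 / (β n)`, the magnetisation per spin of `n` spins
has density proportional to `exp (-n * rate β u)`. -/
noncomputable def rate (β u : ℝ) : ℝ := β * u ^ 2 / 2 - Real.log (Real.cosh (β * u))

theorem map_spinLaw_conv_gaussianReal {n : ℕ} (hn : n ≠ 0) {β r : ℝ} (hβ : 0 < β) (hr : 0 < r) :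
    ((spinLaw n β).map fun x => magnetisation n x / r) ∗
        gaussianReal 0 (n / (β * r ^ 2)).toNNReal =
      volume.tilted fun u => -(n * rate β (r * u / n)) := by
  have : (0 : ℝ) < n := by exact_mod_cast hn.bot_lt
  have hM : Measurable fun x => magnetisation n x / r := (measurable_magnetisation n).div_const r
  have hv : 0 < n / (β * r ^ 2) := by positivity
  have hweight : (fun y : ℝ => β * r ^ 2 / (2 * n) * y ^ 2) =
      fun y => y ^ 2 / (2 * ((n / (β * r ^ 2)).toNNReal : ℝ)) := by
    ext y
    rw [Real.coe_toNNReal _ hv.le]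
    field_simp
  have htilted := Measure.isProbabilityMeasure_map (μ := spinLaw n β) hM.aemeasurable
  have := Measure.isProbabilityMeasure_map (μ := Measure.pi fun _ : Fin n => signLaw)
    hM.aemeasurable
  rw [map_spinLaw_magnetisation_div n β hr.ne', hweight] at htilted ⊢
  rw [tilted_sq_conv_gaussianReal (by simpa using hv)
    integrable_exp_of_isProbabilityMeasure_tilted]
  congr 1 with u
  rw [cgf_map_magnetisation_div, Real.coe_toNNReal _ hv.le, rate]
  field_simp
  ring

end SpinLaw

section LogCosh

theorem hasDerivAt_tanh (x : ℝ) : HasDerivAt Real.tanh (1 - Real.tanh x ^ 2) x := by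
  have hcosh := (Real.cosh_pos x).ne'
  have h : HasDerivAt (fun y => Real.sinh y / Real.cosh y) _ x :=
    (Real.hasDerivAt_sinh x).div (Real.hasDerivAt_cosh x) hcosh
  simp only [← Real.tanh_eq_sinh_div_cosh] at h
  convert h using 1
  rw [Real.tanh_eq_sinh_div_cosh]
  field_simp

theorem strictMono_tanh : StrictMono Real.tanh :=
  strictMono_of_deriv_pos fun x => by
    rw [(hasDerivAt_tanh x).deriv, sub_pos]
    exact (sq_lt_one_iff_abs_lt_one _).2 (Real.abs_tanh_lt_one x)

theorem hasDerivAt_log_cosh (x : ℝ) :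
    HasDerivAt (fun y => Real.log (Real.cosh y)) (Real.tanh x) x := by
  rw [Real.tanh_eq_sinh_div_cosh]
  exact (Real.hasDerivAt_cosh x).log (Real.cosh_pos x).ne'

theorem log_cosh_le_abs (y : ℝ) : Real.log (Real.cosh y) ≤ |y| := by
  rw [Real.log_le_iff_le_exp (Real.cosh_pos y), ← Real.cosh_abs, Real.cosh_eq]
  have : Real.exp (-|y|) ≤ Real.exp |y| := by
    gcongr
    linarith [abs_nonneg y]
  linarith

theorem le_of_hasDerivAt_le {f g f' g' : ℝ → ℝ} (hf : ∀ x, HasDerivAt f (f' x) x)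
    (hg : ∀ x, HasDerivAt g (g' x) x) (h0 : f 0 = g 0) (hle : ∀ x, 0 ≤ x → f' x ≤ g' x)
    {x : ℝ} (hx : 0 ≤ x) : f x ≤ g x := by
  have hd : ∀ y, HasDerivAt (g - f) (g' y - f' y) y := fun y => (hg y).sub (hf y)
  have hmono : MonotoneOn (g - f) (Set.Ici 0) := by
    refine monotoneOn_of_deriv_nonneg (convex_Ici 0)
      (fun y _ => (hd y).continuousAt.continuousWithinAt)
      (fun y _ => (hd y).differentiableAt.differentiableWithinAt) fun y hy => ?_
    rw [interior_Ici] at hy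
    rw [(hd y).deriv]
    exact sub_nonneg.2 (hle y (le_of_lt hy))
  simpa [h0] using hmono Set.self_mem_Ici hx hx

theorem tanh_le_self {y : ℝ} (hy : 0 ≤ y) : Real.tanh y ≤ y :=
  le_of_hasDerivAt_le hasDerivAt_tanh hasDerivAt_id Real.tanh_zero
    (fun x _ => by nlinarith [sq_nonneg (Real.tanh x)]) hy

theorem sq_div_one_add_sq_le_tanh_sq (y : ℝ) : y ^ 2 / (1 + y ^ 2) ≤ Real.tanh y ^ 2 := by
  have hsinh : y ^ 2 ≤ Real.sinh y ^ 2 := by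
    rw [← sq_abs y, ← sq_abs (Real.sinh y), Real.abs_sinh]
    gcongr
    exact Real.self_le_sinh_iff.2 (abs_nonneg y)
  rw [Real.tanh_eq_sinh_div_cosh, div_pow, Real.cosh_sq,
    div_le_div_iff₀ (by positivity) (by positivity)]
  nlinarith

theorem sub_pow_three_div_le_tanh {y : ℝ} (hy : 0 ≤ y) : y - y ^ 3 / 3 ≤ Real.tanh y := by
  refine le_of_hasDerivAt_le (f := fun y => y - y ^ 3 / 3) (f' := fun y => 1 - y ^ 2)
    (fun x => ?_) hasDerivAt_tanh (by simp) (fun x hx => ?_) hy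
  · exact ((hasDerivAt_id x).sub ((hasDerivAt_pow 3 x).div_const 3)).congr_deriv (by
      push_cast; ring)
  · have := tanh_le_self hx
    have : 0 ≤ Real.tanh x := by simpa using strictMono_tanh.monotone hx
    gcongr

theorem tanh_le_sub_pow_three_div {y : ℝ} (hy : 0 ≤ y) :
    Real.tanh y ≤ y - y ^ 3 / (3 * (1 + y ^ 2)) := by
  refine le_of_hasDerivAt_le (g := fun y => y - y ^ 3 / (3 * (1 + y ^ 2)))
    (g' := fun y => 1 - (3 * y ^ 2 + y ^ 4) / (3 * (1 + y ^ 2) ^ 2))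
    hasDerivAt_tanh (fun x => ?_) (by simp) (fun x _ => ?_) hy
  · refine ((hasDerivAt_id x).sub ((hasDerivAt_pow 3 x).div
      (((hasDerivAt_pow 2 x).const_add 1).const_mul 3) (by positivity))).congr_deriv ?_
    push_cast
    field_simp
    ring
  · refine sub_le_sub_left (le_trans ?_ (sq_div_one_add_sq_le_tanh_sq x)) 1
    rw [div_le_div_iff₀ (by positivity) (by positivity)]
    nlinarith [sq_nonneg (x ^ 2), sq_nonneg x, mul_nonneg (sq_nonneg (x ^ 2)) (sq_nonneg x)]

theorem half_sq_sub_log_cosh_le (y : ℝ) : y ^ 2 / 2 - Real.log (Real.cosh y) ≤ y ^ 4 / 12 := by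
  have hpos : ∀ z : ℝ, 0 ≤ z → z ^ 2 / 2 - z ^ 4 / 12 ≤ Real.log (Real.cosh z) := fun z hz => by
    refine le_of_hasDerivAt_le (f := fun z => z ^ 2 / 2 - z ^ 4 / 12)
      (f' := fun z => z - z ^ 3 / 3) (fun x => ?_) hasDerivAt_log_cosh (by simp)
      (fun x hx => sub_pow_three_div_le_tanh hx) hz
    exact (((hasDerivAt_pow 2 x).div_const 2).sub ((hasDerivAt_pow 4 x).div_const 12)).congr_deriv
      (by push_cast; ring)
  have h := hpos |y| (abs_nonneg y)
  rw [Real.cosh_abs, sq_abs, (by decide : Even 4).pow_abs] at h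
  linarith

theorem le_half_sq_sub_log_cosh (y : ℝ) :
    y ^ 4 / (12 * (1 + y ^ 2)) ≤ y ^ 2 / 2 - Real.log (Real.cosh y) := by
  have hpos : ∀ z : ℝ, 0 ≤ z →
      Real.log (Real.cosh z) ≤ z ^ 2 / 2 - z ^ 4 / (12 * (1 + z ^ 2)) := fun z hz => by
    refine le_of_hasDerivAt_le (g := fun z => z ^ 2 / 2 - z ^ 4 / (12 * (1 + z ^ 2)))
      (g' := fun z => z - (2 * z ^ 3 + z ^ 5) / (6 * (1 + z ^ 2) ^ 2)) hasDerivAt_log_cosh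
      (fun x => ?_) (by simp) (fun x hx => ?_) hz
    · refine (((hasDerivAt_pow 2 x).div_const 2).sub ((hasDerivAt_pow 4 x).div
        (((hasDerivAt_pow 2 x).const_add 1).const_mul 12) (by positivity))).congr_deriv ?_
      push_cast
      field_simp
      ring
    · refine (tanh_le_sub_pow_three_div hx).trans (sub_le_sub_left ?_ x)
      rw [div_le_div_iff₀ (by positivity) (by positivity)]
      nlinarith [pow_nonneg hx 3, pow_nonneg hx 5, pow_nonneg hx 7]
  have h := hpos |y| (abs_nonneg y)
  rw [Real.cosh_abs, sq_abs, (by decide : Even 4).pow_abs] at h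
  linarith

end LogCosh

section Asymptotics

theorem continuous_rate (β : ℝ) : Continuous (rate β) := by
  unfold rate
  have := fun u : ℝ => (Real.cosh_pos (β * u)).ne'
  fun_prop (disch := assumption)

theorem rate_le (β u : ℝ) : rate β u ≤ β * (1 - β) * u ^ 2 / 2 + (β * u) ^ 4 / 12 := by
  have := half_sq_sub_log_cosh_le (β * u)
  rw [rate]
  linarith

theorem le_rate (β u : ℝ) :
    β * (1 - β) * u ^ 2 / 2 + (β * u) ^ 4 / (12 * (1 + (β * u) ^ 2)) ≤ rate β u := by
  have := le_half_sq_sub_log_cosh (β * u)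
  rw [rate]
  linarith

theorem tendsto_charFun_map_spinLaw {β r : ℕ → ℝ} {w : ℝ≥0} {Q : Measure ℝ} [IsFiniteMeasure Q]
    {g b : ℝ → ℝ} (hβ : ∀ᶠ n in atTop, 0 < β n) (hr : ∀ᶠ n in atTop, 0 < r n)
    (hv : Tendsto (fun n : ℕ => (n / (β n * r n ^ 2)).toNNReal) atTop (𝓝 w))
    (hb : Integrable fun x => Real.exp (b x))
    (hfb : ∀ᶠ n : ℕ in atTop, ∀ x, -(n * rate (β n) (r n * x / n)) ≤ b x)
    (hlim : ∀ x, Tendsto (fun n : ℕ => -(n * rate (β n) (r n * x / n))) atTop (𝓝 (g x)))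
    (hQ : Q ∗ gaussianReal 0 w = volume.tilted g) (ξ : ℝ) :
    Tendsto (fun n => charFun ((spinLaw n (β n)).map fun x => magnetisation n x / r n) ξ) atTop
      (𝓝 (charFun Q ξ)) := by
  refine tendsto_charFun_of_tendsto_charFun_conv_gaussianReal hv ?_
  rw [hQ]
  have hsmooth : Tendsto
      (fun n : ℕ => charFun (volume.tilted fun x => -(n * rate (β n) (r n * x / n))) ξ) atTop
      (𝓝 (charFun (volume.tilted g) ξ)) := by
    simp only [charFun_apply_real]
    refine tendsto_integral_tilted (fun n => ?_) hb hfb hlim (by fun_prop) (C := 1) fun x => ?_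
    · have := continuous_rate (β n)
      fun_prop
    · rw [← Complex.ofReal_mul, Complex.norm_exp_ofReal_mul_I]
  refine hsmooth.congr' ?_
  filter_upwards [hβ, hr, eventually_ne_atTop 0] with n hβn hrn hn
  rw [map_spinLaw_conv_gaussianReal hn hβn hrn]

end Asymptotics

section Subcritical

theorem sq_sqrt_mul_div {n : ℕ} (hn : n ≠ 0) (x : ℝ) : (√n * x / n) ^ 2 = x ^ 2 / n := by
  rw [div_pow, mul_pow, Real.sq_sqrt n.cast_nonneg]
  field_simp

theorem le_mul_rate_div_sqrt {n : ℕ} (hn : n ≠ 0) (β x : ℝ) :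
    β * (1 - β) * x ^ 2 / 2 ≤ n * rate β (√n * x / n) := by
  have hquartic : 0 ≤ (β * (√n * x / n)) ^ 4 / (12 * (1 + (β * (√n * x / n)) ^ 2)) := by positivity
  calc β * (1 - β) * x ^ 2 / 2 = n * (β * (1 - β) * (√n * x / n) ^ 2 / 2) := by
        rw [sq_sqrt_mul_div hn]; field_simp
    _ ≤ n * rate β (√n * x / n) := by gcongr; linarith [le_rate β (√n * x / n)]

theorem mul_rate_div_sqrt_le {n : ℕ} (hn : n ≠ 0) (β x : ℝ) :
    n * rate β (√n * x / n) ≤ β * (1 - β) * x ^ 2 / 2 + (β * x) ^ 4 / 12 / n := by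
  calc n * rate β (√n * x / n)
      ≤ n * (β * (1 - β) * (√n * x / n) ^ 2 / 2 + (β * (√n * x / n)) ^ 4 / 12) := by
        gcongr; exact rate_le β _
    _ = n * (β * (1 - β) * (√n * x / n) ^ 2 / 2 + β ^ 4 * ((√n * x / n) ^ 2) ^ 2 / 12) := by ring
    _ = β * (1 - β) * x ^ 2 / 2 + (β * x) ^ 4 / 12 / n := by
        rw [sq_sqrt_mul_div hn]; field_simp

theorem tendsto_mul_rate_div_sqrt (β x : ℝ) :
    Tendsto (fun n : ℕ => n * rate β (√n * x / n)) atTop (𝓝 (β * (1 - β) * x ^ 2 / 2)) := by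
  have hupper : Tendsto (fun n : ℕ => β * (1 - β) * x ^ 2 / 2 + (β * x) ^ 4 / 12 / n) atTop
      (𝓝 (β * (1 - β) * x ^ 2 / 2)) := by
    conv_rhs => rw [← add_zero (β * (1 - β) * x ^ 2 / 2)]
    exact (tendsto_natCast_atTop_atTop.const_div_atTop ((β * x) ^ 4 / 12)).const_add _
  exact tendsto_of_tendsto_of_tendsto_of_le_of_le' tendsto_const_nhds hupper
    ((eventually_ne_atTop 0).mono fun n hn => le_mul_rate_div_sqrt hn β x)
    ((eventually_ne_atTop 0).mono fun n hn => mul_rate_div_sqrt_le hn β x)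

theorem gaussianReal_conv_inv_eq_tilted {β : ℝ} (hβ₀ : 0 < β) (hβ₁ : β < 1) :
    gaussianReal 0 (1 / (1 - β)).toNNReal ∗ gaussianReal 0 (1 / β).toNNReal =
      volume.tilted fun x => -(β * (1 - β) * x ^ 2 / 2) := by
  have hβ : 0 < 1 - β := sub_pos.2 hβ₁
  have hvar : 0 < 1 / (1 - β) + 1 / β := by positivity
  rw [gaussianReal_conv_gaussianReal, add_zero, ← Real.toNNReal_add (by positivity) (by positivity),
    gaussianReal_zero_eq_tilted (by simpa using hvar), Real.coe_toNNReal _ hvar.le]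
  congr 1 with x
  field_simp
  ring

theorem tendsto_charFun_map_spinLaw_sqrt {β : ℝ} (hβ₀ : 0 < β) (hβ₁ : β < 1) (ξ : ℝ) :
    Tendsto (fun n : ℕ => charFun ((spinLaw n β).map fun x => magnetisation n x / √n) ξ) atTop
      (𝓝 (charFun (gaussianReal 0 (1 / (1 - β)).toNNReal) ξ)) := by
  have hβ : 0 < β * (1 - β) / 2 := div_pos (mul_pos hβ₀ (sub_pos.2 hβ₁)) two_pos
  have hb : Integrable fun x : ℝ => Real.exp (-(β * (1 - β) * x ^ 2 / 2)) :=
    (integrable_exp_neg_mul_sq hβ).congr (ae_of_all _ fun x => by ring_nf)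
  refine tendsto_charFun_map_spinLaw (.of_forall fun _ => hβ₀) ?_ ?_ hb ?_
    (fun x => (tendsto_mul_rate_div_sqrt β x).neg) (gaussianReal_conv_inv_eq_tilted hβ₀ hβ₁) ξ
  · filter_upwards [eventually_gt_atTop 0] with n hn
    exact Real.sqrt_pos.2 (by exact_mod_cast hn)
  · refine tendsto_const_nhds.congr' ?_
    filter_upwards [eventually_ne_atTop 0] with n hn
    rw [Real.sq_sqrt n.cast_nonneg]
    field_simp
  · filter_upwards [eventually_ne_atTop 0] with n hn x
    exact neg_le_neg (le_mul_rate_div_sqrt hn β x)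

theorem map_spinLaw_eq_tilted_map_spinLaw {n : ℕ} (hn : n ≠ 0) (β β₀ : ℝ) :
    (spinLaw n β).map (fun x => magnetisation n x / √n) =
      ((spinLaw n β₀).map fun x => magnetisation n x / √n).tilted
        fun y => (β - β₀) / 2 * y ^ 2 := by
  have hn' : (0 : ℝ) < n := by exact_mod_cast hn.bot_lt
  have hr : √(n : ℝ) ≠ 0 := (Real.sqrt_pos.2 hn').ne'
  have h₀ := Measure.isProbabilityMeasure_map (μ := spinLaw n β₀)
    ((measurable_magnetisation n).div_const √n).aemeasurable
  rw [map_spinLaw_magnetisation_div n β₀ hr] at h₀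
  rw [map_spinLaw_magnetisation_div n β hr, map_spinLaw_magnetisation_div n β₀ hr,
    tilted_tilted integrable_exp_of_isProbabilityMeasure_tilted]
  congr 1 with y
  rw [Pi.add_apply, Real.sq_sqrt hn'.le]
  field_simp
  ring

-- Smoothing by a Gaussian of variance `1 / β` needs `β > 0`; any other `β` is reached from some
-- `β₀ ∈ (0, 1)` by the bounded weight `exp ((β - β₀) y² / 2)`.
theorem tendstoInDistribution_of_lt_one {β : ℝ} (hβ : β < 1) :
    TendstoInDistribution (fun n x => magnetisation n x / √(n : ℝ)) atTop (fun z : ℝ => z)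
      (fun n => spinLaw n β) (gaussianReal 0 (1 / (1 - β)).toNNReal) := by
  obtain ⟨β₀, hββ₀, hβ₀⟩ := exists_between (max_lt hβ zero_lt_one)
  obtain ⟨hββ₀, hβ₀_pos⟩ := max_lt_iff.1 hββ₀
  have hM : ∀ n, Measurable fun x => magnetisation n x / √(n : ℝ) :=
    fun n => (measurable_magnetisation n).div_const _
  have (n : ℕ) : IsProbabilityMeasure ((spinLaw n β₀).map fun x => magnetisation n x / √n) :=
    Measure.isProbabilityMeasure_map (hM n).aemeasurable
  have hpos : ∀ {b : ℝ}, b < 1 → 0 < 1 / (1 - b) := fun hb => one_div_pos.2 (sub_pos.2 hb)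
  have hlimit : gaussianReal 0 (1 / (1 - β)).toNNReal =
      (gaussianReal 0 (1 / (1 - β₀)).toNNReal).tilted fun y => (β - β₀) / 2 * y ^ 2 := by
    rw [← tilted_gaussianReal_zero (v := (1 / (1 - β₀)).toNNReal) (by simpa using hpos hβ₀)
      (by simpa using hpos hβ), Real.coe_toNNReal _ (hpos hβ₀).le, Real.coe_toNNReal _ (hpos hβ).le]
    congr 1 with y
    simp only [one_div, inv_inv]
    ring
  refine tendstoInDistribution_of_tendsto_charFun hM measurable_id fun ξ => ?_
  rw [Measure.map_id', hlimit]
  refine (tendsto_charFun_tilted (C := 0) (tendsto_charFun_map_spinLaw_sqrt hβ₀_pos hβ₀)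
    (by fun_prop) (fun y => by nlinarith [sq_nonneg y]) ξ).congr' ?_
  filter_upwards [eventually_ne_atTop 0] with n hn
  rw [map_spinLaw_eq_tilted_map_spinLaw hn β β₀]

end Subcritical

section CriticalWindow

theorem sub_le_pow_four_div {A s : ℝ} (hs : 0 ≤ s) (hAs : A * s ≤ 1 / 24) (z : ℝ) :
    A * z ^ 2 - 6 * A ^ 2 ≤ z ^ 4 / (12 * (1 + s * z ^ 2)) := by
  rw [le_div_iff₀ (by positivity)]
  have h : A * s * z ^ 4 ≤ 1 / 24 * z ^ 4 := by gcongr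
  nlinarith [sq_nonneg (z ^ 2 - 12 * A), mul_nonneg hs (mul_nonneg (sq_nonneg A) (sq_nonneg z))]

theorem rate_div_pow_four_le {h : ℝ} (hh : h ≠ 0) (γ x : ℝ) :
    rate (1 - γ * h ^ 2) (h * x) / h ^ 4 ≤
      (1 - γ * h ^ 2) * γ * x ^ 2 / 2 + ((1 - γ * h ^ 2) * x) ^ 4 / 12 := by
  rw [div_le_iff₀ (by positivity)]
  exact (rate_le _ _).trans_eq (by ring)

theorem le_rate_div_pow_four {h : ℝ} (hh : h ≠ 0) (γ x : ℝ) :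
    (1 - γ * h ^ 2) * γ * x ^ 2 / 2 +
        ((1 - γ * h ^ 2) * x) ^ 4 / (12 * (1 + h ^ 2 * ((1 - γ * h ^ 2) * x) ^ 2)) ≤
      rate (1 - γ * h ^ 2) (h * x) / h ^ 4 := by
  rw [le_div_iff₀ (by positivity)]
  refine Eq.trans_le ?_ (le_rate _ _)
  rw [show ((1 - γ * h ^ 2) * (h * x)) ^ 2 = h ^ 2 * ((1 - γ * h ^ 2) * x) ^ 2 by ring]
  ring

theorem tendsto_rate_div_pow_four (γ x : ℝ) :
    Tendsto (fun h => rate (1 - γ * h ^ 2) (h * x) / h ^ 4) (𝓝[≠] 0)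
      (𝓝 (γ * x ^ 2 / 2 + x ^ 4 / 12)) := by
  have hlower : ContinuousAt (fun h : ℝ => (1 - γ * h ^ 2) * γ * x ^ 2 / 2 +
      ((1 - γ * h ^ 2) * x) ^ 4 / (12 * (1 + h ^ 2 * ((1 - γ * h ^ 2) * x) ^ 2))) 0 := by
    fun_prop (disch := norm_num)
  have hupper : ContinuousAt (fun h : ℝ =>
      (1 - γ * h ^ 2) * γ * x ^ 2 / 2 + ((1 - γ * h ^ 2) * x) ^ 4 / 12) 0 := by fun_prop
  refine tendsto_of_tendsto_of_tendsto_of_le_of_le' ?_ ?_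
    (eventually_mem_nhdsWithin.mono fun h hh => le_rate_div_pow_four hh γ x)
    (eventually_mem_nhdsWithin.mono fun h hh => rate_div_pow_four_le hh γ x)
  · simpa using hlower.tendsto.mono_left nhdsWithin_le_nhds
  · simpa using hupper.tendsto.mono_left nhdsWithin_le_nhds

theorem eventually_sub_le_rate_div_pow_four (γ : ℝ) :
    ∀ᶠ h in 𝓝[≠] 0, ∀ x, x ^ 2 - 96 * (|γ| + 1) ^ 2 ≤
      rate (1 - γ * h ^ 2) (h * x) / h ^ 4 := by
  have hβ : ∀ᶠ h : ℝ in 𝓝[≠] 0, |γ * h ^ 2| < 1 / 2 := nhdsWithin_le_nhds <|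
    ContinuousAt.eventually_lt (by fun_prop) continuousAt_const (by norm_num)
  have hA : ∀ᶠ h : ℝ in 𝓝[≠] 0, 4 * (|γ| + 1) * h ^ 2 < 1 / 24 := nhdsWithin_le_nhds <|
    ContinuousAt.eventually_lt (by fun_prop) continuousAt_const (by norm_num)
  filter_upwards [hβ, hA, eventually_mem_nhdsWithin] with h hβ hA hh x
  refine le_trans ?_ (le_rate_div_pow_four hh γ x)
  have hquartic := sub_le_pow_four_div (sq_nonneg h) hA.le ((1 - γ * h ^ 2) * x)
  obtain ⟨hβ₁, hβ₂⟩ := abs_lt.1 hβ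
  have hquadratic : -(3 / 4 * |γ|) ≤ (1 - γ * h ^ 2) * γ / 2 := by
    have : |(1 - γ * h ^ 2) * γ| ≤ 3 / 2 * |γ| := by
      rw [abs_mul, abs_of_pos (by linarith)]
      gcongr
      linarith
    linarith [neg_abs_le ((1 - γ * h ^ 2) * γ)]
  have hscale : 1 / 4 ≤ (1 - γ * h ^ 2) ^ 2 := by nlinarith
  have hcoeff : 1 ≤ (1 - γ * h ^ 2) * γ / 2 + 4 * (|γ| + 1) * (1 - γ * h ^ 2) ^ 2 := by
    nlinarith [abs_nonneg γ]
  nlinarith [mul_le_mul_of_nonneg_right hcoeff (sq_nonneg x)]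

theorem integrable_exp_sub_sq (c : ℝ) : Integrable fun x : ℝ => Real.exp (-(x ^ 2 - c)) := by
  refine ((integrable_exp_neg_mul_sq one_pos).const_mul (Real.exp c)).congr
    (ae_of_all _ fun x => ?_)
  dsimp only
  rw [← Real.exp_add]
  ring_nf

theorem tendsto_rpow_neg_quarter_nhdsNE :
    Tendsto (fun n : ℕ => (n : ℝ) ^ (-(1 / 4) : ℝ)) atTop (𝓝[≠] 0) := by
  refine tendsto_nhdsWithin_iff.2 ⟨(tendsto_rpow_neg_atTop (by norm_num)).comp
    tendsto_natCast_atTop_atTop, ?_⟩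
  filter_upwards [eventually_gt_atTop 0] with n hn
  exact (Real.rpow_pos_of_pos (by exact_mod_cast hn) _).ne'

theorem mul_rate_eq_rate_div_pow_four {n : ℕ} (hn : n ≠ 0) (γ x : ℝ) :
    n * rate (1 - γ / √n) ((n : ℝ) ^ (3 / 4 : ℝ) * x / n) =
      rate (1 - γ * ((n : ℝ) ^ (-(1 / 4) : ℝ)) ^ 2) ((n : ℝ) ^ (-(1 / 4) : ℝ) * x) /
        ((n : ℝ) ^ (-(1 / 4) : ℝ)) ^ 4 := by
  have hn' : (0 : ℝ) < n := by exact_mod_cast hn.bot_lt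
  have hsq : ((n : ℝ) ^ (-(1 / 4) : ℝ)) ^ 2 = (√n)⁻¹ := by
    rw [← Real.rpow_mul_natCast hn'.le, Real.sqrt_eq_rpow, ← Real.rpow_neg hn'.le]
    norm_num
  have hfour : ((n : ℝ) ^ (-(1 / 4) : ℝ)) ^ 4 = (n : ℝ)⁻¹ := by
    rw [← Real.rpow_mul_natCast hn'.le, ← Real.rpow_neg_one]
    norm_num
  have hscale : (n : ℝ) ^ (3 / 4 : ℝ) * x / n = (n : ℝ) ^ (-(1 / 4) : ℝ) * x := by
    rw [mul_div_right_comm, ← Real.rpow_sub_one hn'.ne']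
    norm_num
  rw [hsq, hfour, hscale, div_inv_eq_mul, mul_comm, div_eq_mul_inv]

theorem tendsto_one_sub_div_sqrt (γ : ℝ) :
    Tendsto (fun n : ℕ => 1 - γ / √n) atTop (𝓝 1) := by
  simpa using ((Real.tendsto_sqrt_atTop.comp tendsto_natCast_atTop_atTop).const_div_atTop
    γ).const_sub 1

theorem tendsto_toNNReal_noise_critical_window (γ : ℝ) :
    Tendsto (fun n : ℕ => (n / ((1 - γ / √n) * ((n : ℝ) ^ (3 / 4 : ℝ)) ^ 2)).toNNReal) atTop
      (𝓝 0) := by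
  have hlim : Tendsto (fun n : ℕ => (√n)⁻¹ / (1 - γ / √n)) atTop (𝓝 0) := by
    simpa [Pi.div_def] using (tendsto_inv_atTop_zero.comp
      (Real.tendsto_sqrt_atTop.comp tendsto_natCast_atTop_atTop)).div
      (tendsto_one_sub_div_sqrt γ) one_ne_zero
  rw [← Real.toNNReal_zero]
  refine ((continuous_real_toNNReal.tendsto 0).comp hlim).congr' ?_
  filter_upwards [eventually_ne_atTop 0] with n hn
  have hn' : (0 : ℝ) < n := by exact_mod_cast hn.bot_lt
  have hsq : ((n : ℝ) ^ (3 / 4 : ℝ)) ^ 2 = n * √n := by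
    rw [← Real.rpow_mul_natCast hn'.le, Real.sqrt_eq_rpow,
      ← Real.rpow_one_add' hn'.le (by norm_num)]
    norm_num
  rw [Function.comp_apply, hsq, mul_left_comm, div_mul_cancel_left₀ hn'.ne', mul_inv,
    inv_mul_eq_div, div_eq_mul_inv, mul_comm]

theorem tendstoInDistribution_critical_window (γ : ℝ) :
    TendstoInDistribution (fun n x => magnetisation n x / (n : ℝ) ^ (3 / 4 : ℝ)) atTop
      (fun z : ℝ => z) (fun n => spinLaw n (1 - γ / √(n : ℝ))) (quarticLaw γ) := by
  have hquartic : quarticLaw γ ∗ gaussianReal 0 0 =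
      volume.tilted fun x => -(γ * x ^ 2 / 2 + x ^ 4 / 12) := by
    rw [gaussianReal_zero_var, Measure.conv_dirac_zero, quarticLaw]
    congr 1 with x
    ring
  refine tendstoInDistribution_of_tendsto_charFun
    (fun n => (measurable_magnetisation n).div_const _) measurable_id fun ξ => ?_
  rw [Measure.map_id']
  refine tendsto_charFun_map_spinLaw
    ((tendsto_one_sub_div_sqrt γ).eventually_const_lt one_pos) ?_
    (tendsto_toNNReal_noise_critical_window γ) (integrable_exp_sub_sq (96 * (|γ| + 1) ^ 2))
    ?_ (fun x => ?_) hquartic ξ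
  · filter_upwards [eventually_gt_atTop 0] with n hn
    exact Real.rpow_pos_of_pos (by exact_mod_cast hn) _
  · filter_upwards [tendsto_rpow_neg_quarter_nhdsNE.eventually
      (eventually_sub_le_rate_div_pow_four γ), eventually_ne_atTop 0] with n hbound hn x
    rw [mul_rate_eq_rate_div_pow_four hn]
    exact neg_le_neg (hbound x)
  · refine ((tendsto_rate_div_pow_four γ x).comp tendsto_rpow_neg_quarter_nhdsNE).neg.congr' ?_
    filter_upwards [eventually_ne_atTop 0] with n hn
    rw [mul_rate_eq_rate_div_pow_four hn, Function.comp_apply]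

end CriticalWindow

section Laplace

variable {α : Type*} {mα : MeasurableSpace α} {μ : Measure α} {Ψ : α → ℝ}

theorem exp_neg_succ_mul (n : ℕ) (y : ℝ) :
    Real.exp (-((n + 1 : ℕ) * y)) = Real.exp (-(n * y)) * Real.exp (-y) := by
  rw [← Real.exp_add]
  push_cast
  ring_nf

theorem setIntegral_exp_neg_succ_mul_le (hΨ : Measurable Ψ) {n : ℕ}
    (hone : Integrable (fun x => Real.exp (-Ψ x)) μ)
    (hsucc : Integrable (fun x => Real.exp (-((n + 1 : ℕ) * Ψ x))) μ) (b : ℝ) :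
    ∫ x in {x | b ≤ Ψ x}, Real.exp (-((n + 1 : ℕ) * Ψ x)) ∂μ ≤
      Real.exp (-(n * b)) * ∫ x, Real.exp (-Ψ x) ∂μ := by
  rw [← integral_const_mul]
  refine (setIntegral_mono_on hsucc.integrableOn (hone.const_mul _).integrableOn
    (measurableSet_le measurable_const hΨ) fun x hx => ?_).trans
    (setIntegral_le_integral (hone.const_mul _) (ae_of_all _ fun x => by positivity))
  rw [exp_neg_succ_mul]
  gcongr
  exact hx

theorem exp_neg_mul_setIntegral_le (hΨ : Measurable Ψ) {n : ℕ}
    (hone : Integrable (fun x => Real.exp (-Ψ x)) μ)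
    (hsucc : Integrable (fun x => Real.exp (-((n + 1 : ℕ) * Ψ x))) μ) (a : ℝ) :
    Real.exp (-(n * a)) * ∫ x in {x | Ψ x ≤ a}, Real.exp (-Ψ x) ∂μ ≤
      ∫ x, Real.exp (-((n + 1 : ℕ) * Ψ x)) ∂μ := by
  rw [← integral_const_mul]
  refine (setIntegral_mono_on (hone.const_mul _).integrableOn hsucc.integrableOn
    (measurableSet_le hΨ measurable_const) fun x hx => ?_).trans
    (setIntegral_le_integral hsucc (ae_of_all _ fun x => (Real.exp_pos _).le))
  rw [exp_neg_succ_mul]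
  gcongr
  exact hx

theorem measureReal_tilted_neg_mul_le (hΨ : Measurable Ψ) {n : ℕ}
    (hone : Integrable (fun x => Real.exp (-Ψ x)) μ)
    (hsucc : Integrable (fun x => Real.exp (-((n + 1 : ℕ) * Ψ x))) μ) {a : ℝ}
    (ha : μ {x | Ψ x ≤ a} ≠ 0) (b : ℝ) :
    (μ.tilted fun x => -((n + 1 : ℕ) * Ψ x)).real {x | b ≤ Ψ x} ≤
      (∫ x, Real.exp (-Ψ x) ∂μ) / (∫ x in {x | Ψ x ≤ a}, Real.exp (-Ψ x) ∂μ) *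
        Real.exp (-(n * (b - a))) := by
  have : NeZero (μ.restrict {x | Ψ x ≤ a}) := ⟨by simpa using ha⟩
  have hpos : 0 < ∫ x in {x | Ψ x ≤ a}, Real.exp (-Ψ x) ∂μ := integral_exp_pos hone.integrableOn
  have hexp : Real.exp (-(n * (b - a))) = Real.exp (-(n * b)) / Real.exp (-(n * a)) := by
    rw [← Real.exp_sub]; ring_nf
  rw [measureReal_def, tilted_apply_eq_ofReal_integral' _ (measurableSet_le measurable_const hΨ),
    ENNReal.toReal_ofReal (integral_nonneg fun x => by positivity), integral_div, hexp,
    div_mul_div_comm, mul_comm (∫ x, Real.exp (-Ψ x) ∂μ), mul_comm (∫ x in _, Real.exp (-Ψ x) ∂μ)]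
  exact div_le_div₀ (by positivity) (setIntegral_exp_neg_succ_mul_le hΨ hone hsucc b)
    (by positivity) (exp_neg_mul_setIntegral_le hΨ hone hsucc a)

theorem tendsto_measureReal_tilted_neg_mul (hΨ : Measurable Ψ)
    (hint : ∀ n : ℕ, n ≠ 0 → Integrable (fun x => Real.exp (-(n * Ψ x))) μ) {a b : ℝ} (hab : a < b)
    (ha : μ {x | Ψ x ≤ a} ≠ 0) :
    Tendsto (fun n : ℕ => (μ.tilted fun x => -(n * Ψ x)).real {x | b ≤ Ψ x}) atTop (𝓝 0) := by
  refine (tendsto_add_atTop_iff_nat 1).1 (squeeze_zero (fun n => measureReal_nonneg)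
    (fun n => measureReal_tilted_neg_mul_le hΨ (by simpa using hint 1 one_ne_zero)
      (hint (n + 1) n.succ_ne_zero) ha b) ?_)
  have hdecay : Tendsto (fun n : ℕ => Real.exp (-(n * (b - a)))) atTop (𝓝 0) :=
    Real.tendsto_exp_neg_atTop_nhds_zero.comp
      (tendsto_natCast_atTop_atTop.atTop_mul_const (sub_pos.2 hab))
  simpa using hdecay.const_mul
    ((∫ x, Real.exp (-Ψ x) ∂μ) / ∫ x in {x | Ψ x ≤ a}, Real.exp (-Ψ x) ∂μ)

theorem abs_integral_sub_le_add_mul_measureReal [IsProbabilityMeasure μ] {φ : α → ℝ}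
    (hφ : Measurable φ) {c C : ℝ} (hC : ∀ x, |φ x - c| ≤ C) {ε : ℝ} (hε : 0 ≤ ε) :
    |∫ x, φ x ∂μ - c| ≤ ε + C * μ.real {x | ε ≤ |φ x - c|} := by
  have hset : MeasurableSet {x | ε ≤ |φ x - c|} := measurableSet_le (by fun_prop) (by fun_prop)
  have hint : Integrable (fun x => φ x - c) μ :=
    .of_bound (by fun_prop) C (ae_of_all _ hC)
  have hindicator : Integrable ({x | ε ≤ |φ x - c|}.indicator fun _ => C) μ :=
    (integrable_const C).indicator hset
  have hcenter : ∫ x, φ x ∂μ - c = ∫ x, (φ x - c) ∂μ := by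
    have hφint : Integrable φ μ := (integrable_add_const_iff (c := -c)).1 hint
    rw [integral_sub hφint (integrable_const c)]
    simp
  have hpointwise : ∀ x, |φ x - c| ≤ ε + {x | ε ≤ |φ x - c|}.indicator (fun _ => C) x := fun x => by
    by_cases hx : ε ≤ |φ x - c|
    · rw [Set.indicator_of_mem (by exact hx)]
      linarith [hC x]
    · rw [Set.indicator_of_notMem (by exact hx)]
      linarith
  rw [hcenter]
  calc |∫ x, (φ x - c) ∂μ| ≤ ∫ x, |φ x - c| ∂μ := abs_integral_le_integral_abs
    _ ≤ ∫ x, (ε + {x | ε ≤ |φ x - c|}.indicator (fun _ => C) x) ∂μ :=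
        integral_mono hint.abs ((integrable_const _).add hindicator) hpointwise
    _ = ε + C * μ.real {x | ε ≤ |φ x - c|} := by
        rw [integral_add (integrable_const _) hindicator, integral_indicator_const _ hset]
        simp [mul_comm]

theorem tendsto_integral_of_tendsto_measureReal {P : ℕ → Measure α}
    (hP : ∀ᶠ n in atTop, IsProbabilityMeasure (P n)) {φ : α → ℝ} (hφ : Measurable φ) {c C : ℝ}
    (hC : ∀ x, |φ x - c| ≤ C)
    (h : ∀ ε > 0, Tendsto (fun n => (P n).real {x | ε ≤ |φ x - c|}) atTop (𝓝 0)) :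
    Tendsto (fun n => ∫ x, φ x ∂P n) atTop (𝓝 c) := by
  rw [Metric.tendsto_nhds]
  intro ε hε
  have hsmall : ∀ᶠ n in atTop, C * (P n).real {x | ε / 2 ≤ |φ x - c|} < ε / 2 := by
    refine Tendsto.eventually_lt_const (half_pos hε) ?_
    simpa using (h (ε / 2) (half_pos hε)).const_mul C
  filter_upwards [hP, hsmall] with n hPn hn
  rw [Real.dist_eq]
  linarith [abs_integral_sub_le_add_mul_measureReal (μ := P n) hφ hC (half_pos hε).le]

theorem exists_add_le_of_tendsto_cocompact [TopologicalSpace α] (hΨ : Continuous Ψ)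
    (hproper : Tendsto Ψ (cocompact α) atTop) {x₀ : α} (hmin : ∀ x, Ψ x₀ ≤ Ψ x) {K : Set α}
    (hK : IsClosed K) (hne : ∀ x ∈ K, Ψ x ≠ Ψ x₀) : ∃ δ > 0, ∀ x ∈ K, Ψ x₀ + δ ≤ Ψ x := by
  have hclosed : IsClosed (Ψ '' K) :=
    (isProperMap_iff_tendsto_cocompact.2
      ⟨hΨ, hproper.mono_right atTop_le_cocompact⟩).isClosedMap K hK
  obtain ⟨δ, hδ, hball⟩ := Metric.isOpen_iff.1 hclosed.isOpen_compl (Ψ x₀)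
    (by rintro ⟨x, hx, h⟩; exact hne x hx h)
  refine ⟨δ, hδ, fun x hx => ?_⟩
  by_contra! hlt
  refine hball (?_ : Ψ x ∈ Metric.ball (Ψ x₀) δ) (Set.mem_image_of_mem Ψ hx)
  rw [Metric.mem_ball, Real.dist_eq, abs_of_nonneg (sub_nonneg.2 (hmin x))]
  linarith

theorem tendsto_integral_tilted_neg_mul [TopologicalSpace α] [OpensMeasurableSpace α]
    [μ.IsOpenPosMeasure] (hΨ : Continuous Ψ) (hproper : Tendsto Ψ (cocompact α) atTop)
    (hint : ∀ n : ℕ, n ≠ 0 → Integrable (fun x => Real.exp (-(n * Ψ x))) μ) {x₀ : α}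
    (hmin : ∀ x, Ψ x₀ ≤ Ψ x) {φ : α → ℝ} (hφ : Continuous φ) {C : ℝ} (hC : ∀ x, |φ x| ≤ C)
    (hφ_min : ∀ x, Ψ x = Ψ x₀ → φ x = φ x₀) :
    Tendsto (fun n : ℕ => ∫ x, φ x ∂μ.tilted fun x => -(n * Ψ x)) atTop (𝓝 (φ x₀)) := by
  have : Nonempty α := ⟨x₀⟩
  refine tendsto_integral_of_tendsto_measureReal (C := C + |φ x₀|)
    ((eventually_ne_atTop 0).mono fun n hn => isProbabilityMeasure_tilted (hint n hn))
    hφ.measurable (fun x => (abs_sub _ _).trans (by gcongr; exact hC x)) fun ε hε => ?_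
  obtain ⟨δ, hδ, hgap⟩ := exists_add_le_of_tendsto_cocompact hΨ hproper hmin
    (K := {x | ε ≤ |φ x - φ x₀|}) (isClosed_le (by fun_prop) (by fun_prop)) fun x hx h => by
      simp only [Set.mem_ofPred_eq, hφ_min x h, sub_self, abs_zero] at hx
      linarith
  have hnhds : μ {x | Ψ x ≤ Ψ x₀ + δ / 2} ≠ 0 := by
    refine (Measure.measure_pos_of_mem_nhds μ (x := x₀) ?_).ne'
    exact hΨ.continuousAt.eventually_le_const (by linarith)
  refine squeeze_zero' (.of_forall fun n => measureReal_nonneg) (.of_forall fun n => ?_)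
    (tendsto_measureReal_tilted_neg_mul hΨ.measurable hint (b := Ψ x₀ + δ) (by linarith) hnhds)
  exact measureReal_mono hgap

end Laplace

section Supercritical

variable {β s t : ℝ}

theorem rate_neg (β u : ℝ) : rate β (-u) = rate β u := by
  rw [rate, rate, neg_sq, mul_neg, Real.cosh_neg]

theorem rate_abs (β u : ℝ) : rate β |u| = rate β u := by
  rcases abs_choice u with h | h <;> rw [h]
  exact rate_neg β u

theorem hasDerivAt_rate (β u : ℝ) : HasDerivAt (rate β) (β * (u - Real.tanh (β * u))) u := by
  have hsq : HasDerivAt (fun u : ℝ => β * u ^ 2 / 2) (β * u) u :=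
    (((hasDerivAt_pow 2 u).const_mul β).div_const 2).congr_deriv (by push_cast; ring)
  have hlog := (hasDerivAt_log_cosh (β * u)).comp u ((hasDerivAt_id u).const_mul β)
  exact (hsq.sub hlog).congr_deriv (by ring)

theorem quadratic_le_rate (hβ : 0 ≤ β) (u : ℝ) : β / 4 * u ^ 2 - β ≤ rate β u := by
  have hlog := log_cosh_le_abs (β * u)
  have hsq : 0 ≤ β * (|u| - 2) ^ 2 := by positivity
  rw [abs_mul, abs_of_nonneg hβ] at hlog
  rw [rate, ← sq_abs u]
  linarith

theorem tendsto_rate_cocompact (hβ : 0 < β) : Tendsto (rate β) (cocompact ℝ) atTop := by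
  refine tendsto_atTop_mono (quadratic_le_rate hβ.le) (tendsto_atTop_add_const_right _ _ ?_)
  refine Tendsto.const_mul_atTop (by positivity) ?_
  refine ((tendsto_pow_atTop two_ne_zero).comp tendsto_norm_cocompact_atTop).congr fun u => ?_
  rw [Function.comp_apply, Real.norm_eq_abs, sq_abs]

theorem integrable_exp_neg_mul_rate (hβ : 0 < β) {n : ℕ} (hn : n ≠ 0) :
    Integrable fun u => Real.exp (-(n * rate β u)) := by
  have : (0 : ℝ) < n := by exact_mod_cast hn.bot_lt
  have hcont := continuous_rate β
  refine ((integrable_exp_neg_mul_sq (b := n * (β / 4)) (by positivity)).const_mul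
    (Real.exp (n * β))).mono' (by fun_prop) (ae_of_all _ fun u => ?_)
  rw [Real.norm_eq_abs, Real.abs_exp, ← Real.exp_add, Real.exp_le_exp]
  nlinarith [quadratic_le_rate hβ.le u]

theorem exists_rate_neg (hβ : 1 < β) : ∃ u, rate β u < 0 := by
  have : 0 < β := by linarith
  refine ⟨√((β - 1) / β ^ 3), (rate_le β _).trans_lt ?_⟩
  have hsq : √((β - 1) / β ^ 3) ^ 2 = (β - 1) / β ^ 3 :=
    Real.sq_sqrt (div_nonneg (by linarith) (by positivity))
  have hneg : -(5 / 12 * ((β - 1) ^ 2 / β ^ 2)) < 0 := by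
    have := sub_pos.2 hβ
    rw [neg_lt_zero]
    positivity
  refine Eq.trans_lt ?_ hneg
  rw [mul_pow, show √((β - 1) / β ^ 3) ^ 4 = (√((β - 1) / β ^ 3) ^ 2) ^ 2 by ring, hsq]
  field_simp
  ring

theorem ne_zero_of_forall_rate_le (hβ : 1 < β) (ht : ∀ u, rate β t ≤ rate β u) : t ≠ 0 := by
  rintro rfl
  obtain ⟨u, hu⟩ := exists_rate_neg hβ
  have := ht u
  simp only [rate, mul_zero, Real.cosh_zero, Real.log_one] at this hu
  linarith

theorem eq_tanh_of_forall_rate_le (hβ : β ≠ 0) (ht : ∀ u, rate β t ≤ rate β u) :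
    t = Real.tanh (β * t) := by
  have hmin : IsLocalMin (rate β) t := .of_forall ht
  exact sub_eq_zero.1 ((mul_eq_zero.1 (hmin.hasDerivAt_eq_zero (hasDerivAt_rate β t))).resolve_left
    hβ)

theorem exists_pos_forall_rate_le (hβ : 1 < β) : ∃ t, 0 < t ∧ ∀ u, rate β t ≤ rate β u := by
  obtain ⟨t, ht⟩ :=
    (continuous_rate β).exists_forall_le (tendsto_rate_cocompact (zero_lt_one.trans hβ))
  exact ⟨|t|, abs_pos.2 (ne_zero_of_forall_rate_le hβ ht), by simpa only [rate_abs] using ht⟩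

theorem strictConcaveOn_tanh : StrictConcaveOn ℝ (Set.Ici 0) Real.tanh := by
  refine StrictAntiOn.strictConcaveOn_of_deriv (convex_Ici 0)
    (fun y _ => (hasDerivAt_tanh y).continuousAt.continuousWithinAt) ?_
  intro x hx y _ hxy
  rw [interior_Ici] at hx
  rw [(hasDerivAt_tanh x).deriv, (hasDerivAt_tanh y).deriv]
  have hpos : 0 < Real.tanh x := by simpa using strictMono_tanh hx
  have hlt := strictMono_tanh hxy
  gcongr

theorem strictAntiOn_tanh_div : StrictAntiOn (fun x => Real.tanh x / x) (Set.Ioi 0) := by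
  intro x (hx : 0 < x) y (hy : 0 < y) hxy
  simpa using strictConcaveOn_tanh.secant_strict_mono (a := 0) Set.self_mem_Ici hx.le hy.le hx.ne'
    hy.ne' hxy

theorem eq_of_eq_tanh (hβ : 0 < β) (hs₀ : 0 < s) (hs : s = Real.tanh (β * s)) (ht₀ : 0 < t)
    (ht : t = Real.tanh (β * t)) : s = t := by
  have hslope : ∀ {u : ℝ}, 0 < u → u = Real.tanh (β * u) → Real.tanh (β * u) / (β * u) = β⁻¹ :=
    fun {u} hu₀ hu => by
      rw [← hu]
      field_simp
  exact mul_left_cancel₀ hβ.ne' <| strictAntiOn_tanh_div.injOn (mul_pos hβ hs₀) (mul_pos hβ ht₀)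
    ((hslope hs₀ hs).trans (hslope ht₀ ht).symm)

theorem abs_eq_of_forall_rate_le (hβ : 1 < β) (hs : ∀ u, rate β s ≤ rate β u)
    (ht : ∀ u, rate β t ≤ rate β u) : |s| = |t| := by
  have hβ₀ : 0 < β := zero_lt_one.trans hβ
  refine eq_of_eq_tanh hβ₀ (abs_pos.2 (ne_zero_of_forall_rate_le hβ hs)) ?_
    (abs_pos.2 (ne_zero_of_forall_rate_le hβ ht)) ?_
  · exact eq_tanh_of_forall_rate_le hβ₀.ne' (by simpa only [rate_abs] using hs)
  · exact eq_tanh_of_forall_rate_le hβ₀.ne' (by simpa only [rate_abs] using ht)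

theorem tendsto_charFun_tilted_rate (hβ : 1 < β) (ht : ∀ u, rate β t ≤ rate β u) (ξ : ℝ) :
    Tendsto (fun n : ℕ => charFun (volume.tilted fun u => -(n * rate β u)) ξ) atTop
      (𝓝 (Real.cos (ξ * t) : ℂ)) := by
  have hβ₀ : 0 < β := zero_lt_one.trans hβ
  have (n : ℕ) : (volume.tilted fun u => -(n * rate β u)).IsNegInvariant :=
    isNegInvariant_tilted (by have := continuous_rate β; fun_prop) (by simp [rate_neg])
  simp_rw [charFun_eq_integral_cos]
  refine (Complex.continuous_ofReal.tendsto _).comp ?_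
  refine tendsto_integral_tilted_neg_mul (φ := fun u => Real.cos (ξ * u)) (continuous_rate β)
    (tendsto_rate_cocompact hβ₀) (fun n hn => integrable_exp_neg_mul_rate hβ₀ hn) ht (by fun_prop)
    (fun u => Real.abs_cos_le_one _) fun u hu => ?_
  rw [← Real.cos_abs (ξ * u), ← Real.cos_abs (ξ * t), abs_mul, abs_mul,
    abs_eq_of_forall_rate_le hβ (fun v => hu.trans_le (ht v)) ht]

theorem charFun_map_mul_signLaw (t ξ : ℝ) :
    charFun (signLaw.map fun b => t * b) ξ = Real.cos (ξ * t) := by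
  have : (signLaw.map fun b => t * b).IsNegInvariant :=
    isNegInvariant_map (by fun_prop) (by simp)
  rw [charFun_eq_integral_cos, integral_map (by fun_prop) (by fun_prop), integral_signLaw]
  simp only [mul_one, mul_neg, Real.cos_neg, smul_eq_mul]
  ring_nf

theorem tendstoInDistribution_of_one_lt (hβ : 1 < β) (ht : ∀ u, rate β t ≤ rate β u) :
    TendstoInDistribution (fun n x => magnetisation n x / (n : ℝ)) atTop (fun b : ℝ => t * b)
      (fun n => spinLaw n β) signLaw := by
  have hβ₀ : 0 < β := zero_lt_one.trans hβ
  refine tendstoInDistribution_of_tendsto_charFun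
    (fun n => (measurable_magnetisation n).div_const _) (by fun_prop) fun ξ => ?_
  refine tendsto_charFun_of_tendsto_charFun_conv_gaussianReal (w := 0)
    (v := fun n : ℕ => (n / (β * (n : ℝ) ^ 2)).toNNReal) ?_ ?_
  · have hlim : Tendsto (fun n : ℕ => (β * n)⁻¹) atTop (𝓝 0) :=
      tendsto_inv_atTop_zero.comp (tendsto_natCast_atTop_atTop.const_mul_atTop hβ₀)
    rw [← Real.toNNReal_zero]
    refine ((continuous_real_toNNReal.tendsto 0).comp hlim).congr fun n => ?_
    rw [Function.comp_apply]
    rcases eq_or_ne n 0 with rfl | hn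
    · simp
    · field_simp
  · rw [gaussianReal_zero_var, Measure.conv_dirac_zero, charFun_map_mul_signLaw]
    refine (tendsto_charFun_tilted_rate hβ ht ξ).congr' ?_
    filter_upwards [eventually_ne_atTop 0] with n hn
    rw [map_spinLaw_conv_gaussianReal hn hβ₀ (by exact_mod_cast hn.bot_lt)]
    congr 2 with u
    rw [mul_div_cancel_left₀ u (by exact_mod_cast hn)]

end Supercritical

section GammaSign

theorem integral_gammaMeasure_one_div {p : ℝ} (hp : 0 < p) (F : ℝ → ℝ) :
    ∫ y, F y ∂gammaMeasure (1 / p) 1 =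
      p / Real.Gamma (1 / p) * ∫ x in Set.Ioi 0, Real.exp (-x ^ p) * F (x ^ p) := by
  have hsupp : ∀ y ∉ Set.Ici (0 : ℝ), (gammaPDF (1 / p) 1 y).toReal • F y = 0 := fun y hy => by
    rw [gammaPDF_of_neg (not_le.1 hy), ENNReal.toReal_zero, zero_smul]
  rw [gammaMeasure, integral_withDensity_eq_integral_toReal_smul (f := gammaPDF (1 / p) 1)
      (measurable_gammaPDFReal _ _).ennreal_ofReal (ae_of_all _ fun _ => ENNReal.ofReal_lt_top),
    ← setIntegral_eq_integral_of_forall_compl_eq_zero hsupp, integral_Ici_eq_integral_Ioi,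
    ← integral_comp_rpow_Ioi_of_pos hp, ← integral_const_mul]
  refine setIntegral_congr_fun measurableSet_Ioi fun x (hx : 0 < x) => ?_
  have hpow : x ^ (p - 1) * (x ^ p) ^ (1 / p - 1) = 1 := by
    rw [← Real.rpow_mul hx.le, ← Real.rpow_add hx, mul_sub, mul_one_div_cancel hp.ne']
    simp
  have : 0 < Real.Gamma (1 / p) := Real.Gamma_pos_of_pos (by positivity)
  rw [gammaPDF_of_nonneg (by positivity), ENNReal.toReal_ofReal (by positivity), Real.one_rpow,
    one_mul, smul_eq_mul, smul_eq_mul]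
  linear_combination (p / Real.Gamma (1 / p) * Real.exp (-x ^ p) * F (x ^ p)) * hpow

theorem integral_exp_neg_abs_rpow_div_mul {p c : ℝ} (hp : 0 < p) (hc : 0 < c) (F : ℝ → ℝ) :
    ∫ x : ℝ, Real.exp (-(|x| ^ p / c)) * F (|x| ^ p / c) =
      2 * c ^ (1 / p) * ∫ x in Set.Ioi 0, Real.exp (-x ^ p) * F (x ^ p) := by
  have hroot : 0 < c ^ (1 / p) := by positivity
  have hscale := integral_comp_mul_left_Ioi
    (fun x : ℝ => Real.exp (-(x ^ p / c)) * F (x ^ p / c)) 0 hroot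
  have hpow : ∀ x ∈ Set.Ioi (0 : ℝ), (c ^ (1 / p) * x) ^ p / c = x ^ p := fun x (hx : 0 < x) => by
    rw [Real.mul_rpow hroot.le hx.le, ← Real.rpow_mul hc.le, one_div_mul_cancel hp.ne',
      Real.rpow_one, mul_div_cancel_left₀ _ hc.ne']
  rw [mul_zero, setIntegral_congr_fun measurableSet_Ioi fun x hx => by rw [hpow x hx]] at hscale
  rw [integral_comp_abs (f := fun x => Real.exp (-(x ^ p / c)) * F (x ^ p / c)), hscale,
    smul_eq_mul]
  field_simp

theorem integral_exp_neg_abs_rpow_div_mul_eq_integral_gammaMeasure {p c : ℝ} (hp : 0 < p)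
    (hc : 0 < c) (F : ℝ → ℝ) :
    ∫ x : ℝ, Real.exp (-(|x| ^ p / c)) * F (|x| ^ p / c) =
      2 * c ^ (1 / p) * (Real.Gamma (1 / p) / p) * ∫ y, F y ∂gammaMeasure (1 / p) 1 := by
  have hΓ : Real.Gamma (1 / p) ≠ 0 := (Real.Gamma_pos_of_pos (by positivity)).ne'
  rw [integral_exp_neg_abs_rpow_div_mul hp hc, integral_gammaMeasure_one_div hp]
  field_simp

theorem map_abs_rpow_div_tilted {p c : ℝ} (hp : 0 < p) (hc : 0 < c) :
    (volume.tilted fun x : ℝ => -(|x| ^ p / c)).map (fun x => |x| ^ p / c) =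
      gammaMeasure (1 / p) 1 := by
  have : 0 < Real.Gamma (1 / p) := Real.Gamma_pos_of_pos (by positivity)
  have hK : 0 < 2 * c ^ (1 / p) * (Real.Gamma (1 / p) / p) := by positivity
  have := isProbabilityMeasure_gammaMeasure (one_div_pos.2 hp) one_pos
  have hZ : ∫ x : ℝ, Real.exp (-(|x| ^ p / c)) = 2 * c ^ (1 / p) * (Real.Gamma (1 / p) / p) := by
    have h := integral_exp_neg_abs_rpow_div_mul_eq_integral_gammaMeasure hp hc 1
    simpa only [Pi.one_apply, mul_one, integral_const, probReal_univ, smul_eq_mul] using h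
  refine ext_of_forall_integral_eq_of_IsFiniteMeasure fun F => ?_
  rw [integral_map (by fun_prop) (by fun_prop), integral_tilted, hZ]
  simp_rw [smul_eq_mul, div_mul_eq_mul_div]
  rw [integral_div, integral_exp_neg_abs_rpow_div_mul_eq_integral_gammaMeasure hp hc,
    mul_div_cancel_left₀ _ hK.ne']

theorem map_mul_abs_signLaw_prod (ν : Measure ℝ) [IsFiniteMeasure ν] [ν.IsNegInvariant] :
    (signLaw.prod ν).map (fun p => p.1 * |p.2|) = ν := by
  refine ext_of_forall_integral_eq_of_IsFiniteMeasure fun F => ?_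
  have hint : ∀ {f : ℝ → ℝ}, Continuous f → Integrable (fun y => F (f y)) ν := fun hf =>
    .of_bound (C := ‖F‖) (F.continuous.comp hf).aestronglyMeasurable
      (ae_of_all _ fun y => F.norm_coe_le_norm _)
  have hneg : ∫ y, F (-y) ∂ν = ∫ y, F y ∂ν := by
    conv_rhs => rw [← ν.map_neg_eq_self, integral_map (by fun_prop) (by fun_prop)]
  have hsum : ∀ y, F |y| + F (-|y|) = F y + F (-y) := fun y => by
    rcases abs_choice y with h | h <;> simp [h, add_comm]
  rw [integral_map (by fun_prop) (by fun_prop), integral_prod _ ?_]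
  · calc ∫ x, ∫ y, F (x * |y|) ∂ν ∂signLaw
        = (1 / 2) * ∫ y, (F |y| + F (-|y|)) ∂ν := by
          rw [integral_signLaw, integral_add (hint (by fun_prop)) (hint (by fun_prop))]
          simp only [one_mul, neg_one_mul, smul_eq_mul, mul_add]
      _ = ∫ y, F y ∂ν := by
          simp_rw [hsum]
          rw [integral_add (hint continuous_id') (hint continuous_neg), hneg]
          ring
  · exact .of_bound (C := ‖F‖) (by fun_prop) (ae_of_all _ fun p => F.norm_coe_le_norm _)

theorem quarticLaw_zero : quarticLaw 0 = volume.tilted fun x => -(|x| ^ (4 : ℝ) / 12) := by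
  rw [quarticLaw]
  congr 1 with x
  rw [show (4 : ℝ) = (4 : ℕ) by norm_num, Real.rpow_natCast, (by decide : Even 4).pow_abs]
  norm_num

theorem hasLaw_sign_mul_gamma_rpow {Ω : Type*} [MeasurableSpace Ω] {P : Measure Ω}
    [IsFiniteMeasure P] {B G : Ω → ℝ} (hB : HasLaw B signLaw P)
    (hG : HasLaw G (gammaMeasure (1 / 4) 1) P) (hBG : IndepFun B G P) :
    HasLaw (fun ω => B ω * (12 * G ω) ^ (1 / 4 : ℝ)) (quarticLaw 0) P := by
  have hB_meas := hB.aemeasurable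
  have hG_meas := hG.aemeasurable
  refine ⟨by fun_prop, ?_⟩
  have : (quarticLaw 0).IsNegInvariant := isNegInvariant_tilted (by fun_prop) fun x => by
    simp [(by decide : Even 4).neg_pow]
  have hroot : (fun x : ℝ => (12 * (|x| ^ (4 : ℝ) / 12)) ^ (1 / 4 : ℝ)) = fun x => |x| := by
    ext x
    rw [mul_div_cancel₀ _ (by norm_num), ← Real.rpow_mul (abs_nonneg x)]
    norm_num
  have hquartic : (quarticLaw 0).map (fun x => |x| ^ (4 : ℝ) / 12) = gammaMeasure (1 / 4) 1 := by
    rw [quarticLaw_zero, map_abs_rpow_div_tilted (by norm_num) (by norm_num)]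
  calc P.map (fun ω => B ω * (12 * G ω) ^ (1 / 4 : ℝ))
      = (P.map fun ω => (B ω, G ω)).map (fun p => p.1 * (12 * p.2) ^ (1 / 4 : ℝ)) := by
        rw [AEMeasurable.map_map_of_aemeasurable (by fun_prop) (by fun_prop)]
        rfl
    _ = (signLaw.prod ((quarticLaw 0).map fun x => |x| ^ (4 : ℝ) / 12)).map
          (fun p => p.1 * (12 * p.2) ^ (1 / 4 : ℝ)) := by
        rw [(indepFun_iff_map_prod_eq_prod_map_map hB_meas hG_meas).1 hBG, hB.map_eq, hG.map_eq,
          hquartic]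
    _ = (signLaw.prod (quarticLaw 0)).map (fun p => p.1 * |p.2|) := by
        nth_rw 1 [← signLaw.map_id]
        rw [Measure.map_prod_map _ _ measurable_id (by fun_prop),
          Measure.map_map (by fun_prop) (by fun_prop)]
        congr 1 with p
        exact congrArg (p.1 * ·) (congrFun hroot p.2)
    _ = quarticLaw 0 := map_mul_abs_signLaw_prod _

end GammaSign

end CurieWeiss

theorem theorem1 :
    -- subcritical regime
    (∀ β : ℝ, β < 1 →
      TendstoInDistribution
        (fun n x => CurieWeiss.magnetisation n x / √(n : ℝ)) atTop
        (fun z : ℝ => z)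
        (fun n => CurieWeiss.spinLaw n β) (gaussianReal 0 (1 / (1 - β)).toNNReal)) ∧
    -- critical temperature
    (TendstoInDistribution
        (fun n x => CurieWeiss.magnetisation n x / (n : ℝ) ^ (3 / 4 : ℝ)) atTop
        (fun z : ℝ => z)
        (fun n => CurieWeiss.spinLaw n 1) (CurieWeiss.quarticLaw 0) ∧
      ∀ (Ω : Type*) [MeasurableSpace Ω] (P : Measure Ω) [IsProbabilityMeasure P] (B G : Ω → ℝ),
        HasLaw B CurieWeiss.signLaw P → HasLaw G (gammaMeasure (1 / 4) 1) P → IndepFun B G P →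
        HasLaw (fun ω => B ω * (12 * G ω) ^ (1 / 4 : ℝ)) (CurieWeiss.quarticLaw 0) P) ∧
    -- critical window
    (∀ γ : ℝ,
      TendstoInDistribution
        (fun n x => CurieWeiss.magnetisation n x / (n : ℝ) ^ (3 / 4 : ℝ)) atTop
        (fun z : ℝ => z)
        (fun n => CurieWeiss.spinLaw n (1 - γ / √(n : ℝ))) (CurieWeiss.quarticLaw γ)) ∧
    -- supercritical regime
    (∀ β : ℝ, 1 < β →
      ∃ t : ℝ, 0 < t ∧ t = Real.tanh (β * t) ∧
        (∀ s : ℝ, 0 < s → s = Real.tanh (β * s) → s = t) ∧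
        TendstoInDistribution
          (fun n x => CurieWeiss.magnetisation n x / (n : ℝ)) atTop
          (fun b : ℝ => t * b)
          (fun n => CurieWeiss.spinLaw n β) CurieWeiss.signLaw) := by
  refine ⟨fun β hβ => CurieWeiss.tendstoInDistribution_of_lt_one hβ, ⟨?_, ?_⟩,
    CurieWeiss.tendstoInDistribution_critical_window, fun β hβ => ?_⟩
  · simpa only [zero_div, sub_zero] using CurieWeiss.tendstoInDistribution_critical_window 0
  · intro Ω _ P _ B G hB hG hBG
    exact CurieWeiss.hasLaw_sign_mul_gamma_rpow hB hG hBG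
  · have hβ₀ : 0 < β := zero_lt_one.trans hβ
    obtain ⟨t, ht₀, hmin⟩ := CurieWeiss.exists_pos_forall_rate_le hβ
    have ht := CurieWeiss.eq_tanh_of_forall_rate_le hβ₀.ne' hmin
    exact ⟨t, ht₀, ht, fun s hs₀ hs => CurieWeiss.eq_of_eq_tanh hβ₀ hs₀ hs ht₀ ht,
      CurieWeiss.tendstoInDistribution_of_one_lt hβ hmin⟩
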